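/- Let $N\in\mathbb N$, $p\in\{0\}\cup[1,\infty]$, let $X$ be a (real or complex) Banach space and $\mathbf X=l^p(\mathbb Z^N,X)$ with the usual $p$-norm, where $l^0(\mathbb Z^N,X)$ is the closure in $l^\infty(\mathbb Z^N,X)$ of the finitely supported sequences. Write $\mathcal L(\mathbf X)$ for the algebra of bounded linear operators on $\mathbf X$, $P_n$ for the multiplication by the characteristic function of $\{-n,\dots,n\}^N$, and $V_\alpha$ ($\alpha\in\mathbb Z^N$) for the shift $(V_\alpha x)_i=x_{i-\alpha}$. An operator $K\in\mathcal L(\mathbf X)$ is $\mathcal P$-compact if $\|(I-P_n)K\|+\|K(I-P_n)\|\to0$ as $n\to\infty$; $\mathcal L(\mathbf X,\mathcal P)$ is the set of all $A\in\mathcal L(\mathbf X)$ such that $AK$ and $KA$ are $\mathcal P$-compact for every $\mathcal P$-compact $K$. A bounded sequence $(A_n)$ in $\mathcal L(\mathbf X,\mathcal P)$ converges $\mathcal P$-strongly to $B\in\mathcal L(\mathbf X)$ if $\|P_m(A_n-B)\|+\|(A_n-B)P_m\|\to0$ as $n\to\infty$ for every $m\in\mathbb N$. For $A\in\mathcal L(\mathbf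 X,\mathcal P)$ and a sequence $h=(h_n)$ in $\mathbb Z^N$ with $|h_n|\to\infty$, the limit operator $A_h$ is the $\mathcal P$-strong limit of $V_{-h_n}AV_{h_n}$, if it exists; $\sigma_{\mathrm{op}}(A)$ is the set of all limit operators of $A$. $A$ is rich if $A\in\mathcal L(\mathbf X,\mathcal P)$ and every sequence $h$ in $\mathbb Z^N$ tending to infinity has a subsequence $g$ such that $A_g$ exists. A band operator is a finite sum $\sum_\alpha a_\alpha V_\alpha$, where each $a_\alpha\in l^\infty(\mathbb Z^N,\mathcal L(X))$ acts by $(a_\alpha x)_i=(a_\alpha)_i x_i$; an operator is band-dominated if it is the limit in operator norm of a sequence of band operators. The lower norm of $B\in\mathcal L(\mathbf X)$ is $\nu(B)=\inf\{\|Bx\|:\|x\|=1\}$ (infima over the empty set being $+\infty$). Let $A\in\mathcal L(\mathbf X)$ be rich and band-dominated. If every operator in $\sigma_{\mathrm{op}}(A)$ is invertible in $\mathcal L(\mathbf X)$, then the norms of their inverses are uniformly bounded, i.e. there is a constant $C$ with $\|B^{-1}\|\le C$ for all $B\in\sigma_{\mathrm{op}}(A)$; equivalently, $\inf\{\nu(B):B\in\sigma_{\mathrm{op}}(A)\}>0$.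 -/

import Mathlib

open Filter Topology
open scoped ENNReal

noncomputable section

namespace LimitOp

/-- The index group `ℤ^N`. Its norm is the maximum norm. -/
abbrev Idx (N : ℕ) : Type := Fin N → ℤ

/-- The exponent of the norm of `l^p`: the space `l^0` carries the norm of `l^∞`. -/
def normExp (p : ℝ≥0∞) : ℝ≥0∞ := if p = 0 then ∞ else p

instance fact_one_le_normExp (p : ℝ≥0∞) [hp : Fact (p = 0 ∨ 1 ≤ p)] : Fact (1 ≤ normExp p) :=
  ⟨by
    unfold normExp
    split_ifs with h
    · exact le_top
    · exact hp.out.resolve_left h⟩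

theorem normExp_ne_zero (p : ℝ≥0∞) : normExp p ≠ 0 := by
  unfold normExp
  split_ifs with h
  · exact ENNReal.top_ne_zero
  · exact h

/-- All `X`-valued families over `ℤ^N` with finite `p`-norm (finite `∞`-norm if `p = 0`). -/
abbrev Amb (N : ℕ) (X : Type*) [NormedAddCommGroup X] (p : ℝ≥0∞) : Type _ :=
  lp (fun _ : Idx N => X) (normExp p)

set_option linter.unusedSectionVars false

section Ambient

variable (𝕜 : Type*) [RCLike 𝕜] (N : ℕ) (X : Type*) [NormedAddCommGroup X] [NormedSpace 𝕜 X]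
  (p : ℝ≥0∞) [hp : Fact (p = 0 ∨ 1 ≤ p)]

/-- The families of finite support. -/
def finSupp : Submodule 𝕜 (Amb N X p) where
  carrier := {x | {i : Idx N | x i ≠ 0}.Finite}
  zero_mem' := by simp
  add_mem' := by
    intro x y hx hy
    refine (Set.Finite.union hx hy).subset ?_
    intro i hi
    by_contra h
    simp only [Set.mem_union, Set.mem_ofPred_eq, not_or, not_not] at h
    exact hi (by simp [h.1, h.2])
  smul_mem' := by
    intro c x hx
    refine Set.Finite.subset hx ?_
    intro i hi h
    exact hi (by simp [h])

/-- The sequence space `l^p(ℤ^N, X)`, `p ∈ {0} ∪ [1, ∞]`. For `p ∈ [1, ∞]` it is the usual space,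
and `l^0(ℤ^N, X)` is the closure in `l^∞(ℤ^N, X)` of the families of finite support. -/
def seqSpace : Submodule 𝕜 (Amb N X p) :=
  if p = 0 then (finSupp 𝕜 N X p).topologicalClosure else ⊤

theorem seqSpace_zero [Fact ((0 : ℝ≥0∞) = 0 ∨ 1 ≤ (0 : ℝ≥0∞))] :
    seqSpace 𝕜 N X 0 = (finSupp 𝕜 N X 0).topologicalClosure := if_pos rfl

theorem seqSpace_of_ne_zero (h : p ≠ 0) : seqSpace 𝕜 N X p = ⊤ := if_neg h

/-- The space `l^p(ℤ^N, X)` as a type, with the norm inherited from the ambient space. -/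
def SeqSpace : Type _ := seqSpace 𝕜 N X p

instance : NormedAddCommGroup (SeqSpace 𝕜 N X p) :=
  inferInstanceAs (NormedAddCommGroup (seqSpace 𝕜 N X p))

instance : NormedSpace 𝕜 (SeqSpace 𝕜 N X p) :=
  inferInstanceAs (NormedSpace 𝕜 (seqSpace 𝕜 N X p))

/-- The algebra `L(𝐗)` of bounded linear operators on `𝐗 = l^p(ℤ^N, X)`. -/
abbrev Op : Type _ := SeqSpace 𝕜 N X p →L[𝕜] SeqSpace 𝕜 N X p

end Ambient

section Operators

variable {𝕜 : Type*} [RCLike 𝕜] {N : ℕ} {X : Type*} [NormedAddCommGroup X] [NormedSpace 𝕜 X]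
  {p : ℝ≥0∞} [hp : Fact (p = 0 ∨ 1 ≤ p)]

/-- The entries `x_i` of a sequence `x`. -/
instance : CoeFun (SeqSpace 𝕜 N X p) (fun _ => Idx N → X) := ⟨fun x i => (x.1 : Amb N X p) i⟩

theorem SeqSpace.ext {x y : SeqSpace 𝕜 N X p} (h : ∀ i, x i = y i) : x = y :=
  Subtype.ext (lp.ext (funext h))

theorem SeqSpace.norm_def (x : SeqSpace 𝕜 N X p) : ‖x‖ = ‖(x.1 : Amb N X p)‖ := rfl

theorem SeqSpace.zero_apply (i : Idx N) : (0 : SeqSpace 𝕜 N X p) i = 0 := rfl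

theorem SeqSpace.add_apply (x y : SeqSpace 𝕜 N X p) (i : Idx N) : (x + y) i = x i + y i := rfl

theorem SeqSpace.sub_apply (x y : SeqSpace 𝕜 N X p) (i : Idx N) : (x - y) i = x i - y i := rfl

theorem SeqSpace.smul_apply (c : 𝕜) (x : SeqSpace 𝕜 N X p) (i : Idx N) :
    (c • x) i = c • x i := rfl

/-- An operator on the ambient space that preserves finiteness of supports maps `l^p` to itself. -/
theorem mapsTo_seqSpace (T : Amb N X p →L[𝕜] Amb N X p)
    (hT : ∀ x ∈ finSupp 𝕜 N X p, T x ∈ finSupp 𝕜 N X p) :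
    ∀ x ∈ seqSpace 𝕜 N X p, T x ∈ seqSpace 𝕜 N X p := by
  intro x hx
  unfold seqSpace at hx ⊢
  split_ifs at hx ⊢ with h
  · exact map_mem_closure T.continuous hx hT
  · trivial

/-- The restriction to `l^p` of an operator on the ambient space that preserves `l^p`. -/
def restrictOp (T : Amb N X p →L[𝕜] Amb N X p)
    (hT : ∀ x ∈ seqSpace 𝕜 N X p, T x ∈ seqSpace 𝕜 N X p) : Op 𝕜 N X p :=
  LinearMap.mkContinuous
    { toFun := fun x => ⟨T x.1, hT x.1 x.2⟩
      map_add' := fun x y => Subtype.ext (map_add T x.1 y.1)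
      map_smul' := fun c x => Subtype.ext (map_smul T c x.1) }
    ‖T‖ (fun x => T.le_opNorm x.1)

/-! ### Multiplication operators -/

theorem norm_mul_apply_le (a : lp (fun _ : Idx N => X →L[𝕜] X) ∞) (x : Amb N X p) (i : Idx N) :
    ‖a i (x i)‖ ≤ ‖(((‖a‖ : ℝ) : 𝕜) • x : Amb N X p) i‖ := by
  rw [lp.coeFn_smul, Pi.smul_apply, norm_smul, RCLike.norm_ofReal, abs_norm]
  exact (a i).le_of_opNorm_le (lp.norm_apply_le_norm ENNReal.top_ne_zero a i) _

/-- `(ax)_i = a_i x_i` on the ambient space. -/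
def mulAmb (a : lp (fun _ : Idx N => X →L[𝕜] X) ∞) : Amb N X p →L[𝕜] Amb N X p :=
  LinearMap.mkContinuous
    { toFun := fun x => ⟨fun i => a i (x i),
        Memℓp.mono' (lp.memℓp (((‖a‖ : ℝ) : 𝕜) • x)) (norm_mul_apply_le a x)⟩
      map_add' := by
        intro x y
        ext i
        exact map_add (a i) (x i) (y i)
      map_smul' := by
        intro c x
        ext i
        simp }
    ‖a‖ (by
      intro x
      refine (lp.norm_mono (normExp_ne_zero p) (norm_mul_apply_le a x)).trans ?_
      rw [norm_smul, RCLike.norm_ofReal, abs_norm])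

theorem mulAmb_apply (a : lp (fun _ : Idx N => X →L[𝕜] X) ∞) (x : Amb N X p) (i : Idx N) :
    mulAmb a x i = a i (x i) := rfl

theorem mulAmb_mem (a : lp (fun _ : Idx N => X →L[𝕜] X) ∞) :
    ∀ x ∈ seqSpace 𝕜 N X p, mulAmb a x ∈ seqSpace 𝕜 N X p := by
  refine mapsTo_seqSpace _ ?_
  intro x hx
  refine Set.Finite.subset hx ?_
  intro i hi h
  exact hi (by rw [mulAmb_apply, h, map_zero])

/-- The multiplication operator `aI`, `(ax)_i = a_i x_i`, of `a ∈ l^∞(ℤ^N, L(X))`. -/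
def mulOp (a : lp (fun _ : Idx N => X →L[𝕜] X) ∞) : Op 𝕜 N X p :=
  restrictOp (mulAmb a) (mulAmb_mem a)

theorem mulOp_apply (a : lp (fun _ : Idx N => X →L[𝕜] X) ∞) (x : SeqSpace 𝕜 N X p) (i : Idx N) :
    mulOp a x i = a i (x i) := rfl

/-! ### Shifts -/

theorem memℓp_shift {q : ℝ≥0∞} (hq : q ≠ 0) (α : Idx N) (x : Idx N → X) (hx : Memℓp x q) :
    Memℓp (fun i => x (i - α)) q := by
  rcases q.trichotomy with rfl | rfl | h
  · exact absurd rfl hq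
  · refine memℓp_infty ((memℓp_infty_iff.1 hx).mono ?_)
    rintro _ ⟨i, rfl⟩
    exact ⟨i - α, rfl⟩
  · rw [memℓp_gen_iff h] at hx ⊢
    exact (Equiv.subRight α).summable_iff.2 hx

theorem norm_shift_le (α : Idx N) (x : Amb N X p) :
    ‖(⟨fun i => x (i - α), memℓp_shift (normExp_ne_zero p) α x (lp.memℓp x)⟩ : Amb N X p)‖ ≤ ‖x‖ := by
  rcases eq_or_ne (normExp p) ∞ with h | h
  · have key : ∀ (q : ℝ≥0∞) (_ : q = ∞) (y z : lp (fun _ : Idx N => X) q),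
        (∀ i, y i = z (i - α)) → ‖y‖ ≤ ‖z‖ := by
      rintro q rfl y z hyz
      refine lp.norm_le_of_forall_le (norm_nonneg _) ?_
      intro i
      rw [hyz i]
      exact lp.norm_apply_le_norm ENNReal.top_ne_zero z _
    exact key _ h _ _ (fun i => rfl)
  · have h0 : 0 < (normExp p).toReal := ENNReal.toReal_pos (normExp_ne_zero p) h
    refine lp.norm_le_of_tsum_le h0 (norm_nonneg _) ?_
    rw [lp.norm_rpow_eq_tsum h0 x]
    exact ((Equiv.subRight α).tsum_eq (fun i => ‖x i‖ ^ (normExp p).toReal)).le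

/-- `(V_α x)_i = x_{i - α}` on the ambient space. -/
def shiftAmb (α : Idx N) : Amb N X p →L[𝕜] Amb N X p :=
  LinearMap.mkContinuous
    { toFun := fun x => ⟨fun i => x (i - α), memℓp_shift (normExp_ne_zero p) α x (lp.memℓp x)⟩
      map_add' := by
        intro x y
        ext i
        rfl
      map_smul' := by
        intro c x
        ext i
        simp }
    1 (by
      intro x
      rw [one_mul]
      exact norm_shift_le α x)

theorem shiftAmb_apply (α : Idx N) (x : Amb N X p) (i : Idx N) :
    shiftAmb (𝕜 := 𝕜) α x i = x (i - α) := rfl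

theorem shiftAmb_mem (α : Idx N) :
    ∀ x ∈ seqSpace 𝕜 N X p, shiftAmb (𝕜 := 𝕜) α x ∈ seqSpace 𝕜 N X p := by
  refine mapsTo_seqSpace _ ?_
  intro x hx
  exact Set.Finite.preimage (f := fun i : Idx N => i - α) (sub_left_injective.injOn) hx

variable (𝕜 N X p) in
/-- The shift operator `V_α`, `(V_α x)_i = x_{i - α}`. -/
def shift (α : Idx N) : Op 𝕜 N X p :=
  restrictOp (shiftAmb α) (shiftAmb_mem α)

theorem shift_apply (α : Idx N) (x : SeqSpace 𝕜 N X p) (i : Idx N) :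
    shift 𝕜 N X p α x i = x (i - α) := rfl

/-! ### The projections `P_n` -/

/-- The cube `{-n, …, n}^N`. -/
def cube (N n : ℕ) : Set (Idx N) := {i | ∀ k, -(n : ℤ) ≤ i k ∧ i k ≤ n}

variable (𝕜 X) in
open Classical in
/-- The characteristic function of `F ⊆ ℤ^N`, with values in `{0, I} ⊆ L(X)`. -/
def charFun (F : Set (Idx N)) : lp (fun _ : Idx N => X →L[𝕜] X) ∞ :=
  ⟨fun i => if i ∈ F then ContinuousLinearMap.id 𝕜 X else 0, memℓp_infty ⟨1, by
    rintro _ ⟨i, rfl⟩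
    dsimp only
    split_ifs
    · exact ContinuousLinearMap.norm_id_le
    · simp⟩⟩

variable (𝕜 N X p) in
/-- The canonical projection `P_n`, the multiplication by the characteristic function of
`{-n, …, n}^N`. -/
def proj (n : ℕ) : Op 𝕜 N X p := mulOp (charFun 𝕜 X (cube N n))

open Classical in
theorem proj_apply (n : ℕ) (x : SeqSpace 𝕜 N X p) (i : Idx N) :
    proj 𝕜 N X p n x i = if i ∈ cube N n then x i else 0 := by
  rw [proj, mulOp_apply]
  simp only [charFun]
  split_ifs <;> rfl

/-! ### `𝒫`-compactness, `L(𝐗, 𝒫)` and `𝒫`-strong convergence -/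

/-- `K` is `𝒫`-compact: `‖(I - P_n) K‖ + ‖K (I - P_n)‖ → 0`. -/
def IsPCompact (K : Op 𝕜 N X p) : Prop :=
  Tendsto (fun n : ℕ => ‖(1 - proj 𝕜 N X p n) * K‖ + ‖K * (1 - proj 𝕜 N X p n)‖) atTop (𝓝 0)

variable (𝕜 N X p) in
/-- `L(𝐗, 𝒫)`: the operators `A` such that `AK` and `KA` are `𝒫`-compact whenever `K` is. -/
def LP : Set (Op 𝕜 N X p) :=
  {A | ∀ K : Op 𝕜 N X p, IsPCompact K → IsPCompact (A * K) ∧ IsPCompact (K * A)}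

/-- The bounded sequence `(A_n)` in `L(𝐗, 𝒫)` converges `𝒫`-strongly to `B ∈ L(𝐗)`. -/
def PStrongTendsto (A : ℕ → Op 𝕜 N X p) (B : Op 𝕜 N X p) : Prop :=
  (∀ n, A n ∈ LP 𝕜 N X p) ∧ (∃ C : ℝ, ∀ n, ‖A n‖ ≤ C) ∧
    ∀ m : ℕ, Tendsto (fun n => ‖proj 𝕜 N X p m * (A n - B)‖ + ‖(A n - B) * proj 𝕜 N X p m‖)
      atTop (𝓝 0)

/-! ### Band-dominated operators -/

/-- Band operators: finite sums `∑ a_α V_α` with multiplication operators `a_α I`. -/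
def IsBand (A : Op 𝕜 N X p) : Prop :=
  ∃ (s : Finset (Idx N)) (a : Idx N → lp (fun _ : Idx N => X →L[𝕜] X) ∞),
    A = ∑ α ∈ s, mulOp (a α) * shift 𝕜 N X p α

/-- Band-dominated operators: limits, in the operator norm, of sequences of band operators. -/
def IsBandDominated (A : Op 𝕜 N X p) : Prop :=
  ∃ B : ℕ → Op 𝕜 N X p, (∀ n, IsBand (B n)) ∧ Tendsto B atTop (𝓝 A)

/-! ### Limit operators -/

/-- The sequence `h` in `ℤ^N` tends to infinity. -/
def TendsToInfinity (h : ℕ → Idx N) : Prop := Tendsto (fun n => ‖h n‖) atTop atTop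

/-- `B` is the limit operator `A_h`, i.e. the `𝒫`-strong limit of `V_{-h_n} A V_{h_n}`. -/
def IsLimitOperator (A : Op 𝕜 N X p) (h : ℕ → Idx N) (B : Op 𝕜 N X p) : Prop :=
  PStrongTendsto (fun n => shift 𝕜 N X p (-h n) * A * shift 𝕜 N X p (h n)) B

/-- The operator spectrum `σ_op(A)`, the set of all limit operators of `A`. -/
def opSpectrum (A : Op 𝕜 N X p) : Set (Op 𝕜 N X p) :=
  {B | ∃ h : ℕ → Idx N, TendsToInfinity h ∧ IsLimitOperator A h B}

/-- `A` is rich: `A ∈ L(𝐗, 𝒫)` and each sequence tending to infinity has a subsequence with respect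
to which the limit operator exists. -/
def IsRich (A : Op 𝕜 N X p) : Prop :=
  A ∈ LP 𝕜 N X p ∧ ∀ h : ℕ → Idx N, TendsToInfinity h →
    ∃ φ : ℕ → ℕ, StrictMono φ ∧ ∃ B : Op 𝕜 N X p, IsLimitOperator A (h ∘ φ) B

end Operators

/-- The lower norm `ν(A) = inf {‖Ay‖ : ‖y‖ = 1}`, as an element of `[0, ∞]`; it is `∞` if there
is no unit vector. -/
def lowerNorm {𝕜 Y Z : Type*} [RCLike 𝕜] [NormedAddCommGroup Y] [NormedSpace 𝕜 Y]
    [NormedAddCommGroup Z] [NormedSpace 𝕜 Z] (A : Y →L[𝕜] Z) : ℝ≥0∞ :=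
  ⨅ (y : Y) (_ : ‖y‖ = 1), ENNReal.ofReal ‖A y‖

end LimitOp

end

noncomputable section

namespace LimitOp

open MeasureTheory

/-! ### Entrywise norms, shifts, tent multipliers and their commutators. -/

section Basic

variable {𝕜 : Type*} [RCLike 𝕜] {N : ℕ} {X : Type*} [NormedAddCommGroup X] [NormedSpace 𝕜 X]
  {p : ℝ≥0∞} [hp : Fact (p = 0 ∨ 1 ≤ p)]

/-! If the limit operators had no common lower bound, a single limit operator could be built that
fails to be bounded below, against invertibility.

The engine is `IsBandDominated.exists_localization`: a vector with `‖A x‖ ≤ ε‖x‖` can be cut down,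
at the cost of `δ`, to a piece of its own support of diameter `D(δ)`, independent of `x` and `ε`.
The cutting multiplies by a wide tent, which almost commutes with `A`. For the sup norm the tent is
centred where `x` is nearly maximal; for finite exponents a good centre exists by averaging over all
translates.

Take limit operators with lower bounds tending to `0`. Their almost-kernel vectors, truncated and
shifted, become almost-kernel vectors of `A` supported outside the ball of radius `n`
(`IsLimitOperator.exists_far_support`). Cutting successively with `δ = 2^{-(n-1)}, …, 1/2, 1` gives
nested supports, so one point `c_n` sees vectors of every size `D_k`, `k < n`, with defect `1/(n+1)
+ 2·2^{-k}` (`exists_common_center`). Richness provides a limit operator `C` along a subsequence of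
`c_n`. For fixed `k`, the vectors translated by `-c_n` lie in a fixed cube, where the convergence to
`C` is in norm. So `C` has defect of order `2^{-k}` for every `k`, and is not bounded below. -/

theorem SeqSpace.norm_mono {x y : SeqSpace 𝕜 N X p} (h : ∀ i, ‖x i‖ ≤ ‖y i‖) : ‖x‖ ≤ ‖y‖ :=
  lp.norm_mono (normExp_ne_zero p) h

theorem SeqSpace.norm_apply_le (x : SeqSpace 𝕜 N X p) (i : Idx N) : ‖x i‖ ≤ ‖x‖ :=
  lp.norm_apply_le_norm (normExp_ne_zero p) x.1 i

theorem SeqSpace.norm_le_mul {x y : SeqSpace 𝕜 N X p} {c : ℝ} (hc : 0 ≤ c)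
    (h : ∀ i, ‖x i‖ ≤ c * ‖y i‖) : ‖x‖ ≤ c * ‖y‖ := by
  have h1 : ‖x‖ ≤ ‖(c : 𝕜) • y‖ := SeqSpace.norm_mono fun i => by
    rw [SeqSpace.smul_apply, norm_smul, RCLike.norm_ofReal, abs_of_nonneg hc]
    exact h i
  rwa [norm_smul, RCLike.norm_ofReal, abs_of_nonneg hc] at h1

/-- The norm is a supremum here; this covers both `p = ∞` and `p = 0`. -/
theorem SeqSpace.exists_lt_norm_apply (hq : normExp p = ∞) (x : SeqSpace 𝕜 N X p) {c : ℝ}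
    (hc0 : 0 ≤ c) (hc : c < ‖x‖) : ∃ i, c < ‖x i‖ := by
  by_contra! h
  have key : ∀ (q : ℝ≥0∞) (_ : q = ∞) (y : lp (fun _ : Idx N => X) q),
      (∀ i, ‖y i‖ ≤ c) → ‖y‖ ≤ c := by
    rintro q rfl y hy
    exact lp.norm_le_of_forall_le hc0 hy
  exact absurd (key _ hq x.1 h) (not_le.2 hc)

theorem SeqSpace.exists_ne_zero {x : SeqSpace 𝕜 N X p} (hx : x ≠ 0) : ∃ i, x i ≠ 0 := by
  by_contra! h
  exact hx (SeqSpace.ext h)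

theorem norm_mulOp_le (a : lp (fun _ : Idx N => X →L[𝕜] X) ∞) (x : SeqSpace 𝕜 N X p) :
    ‖mulOp a x‖ ≤ ‖a‖ * ‖x‖ :=
  SeqSpace.norm_le_mul (norm_nonneg _) fun i =>
    (a i).le_of_opNorm_le (lp.norm_apply_le_norm ENNReal.top_ne_zero a i) _

theorem shift_shift (α β : Idx N) (x : SeqSpace 𝕜 N X p) :
    shift 𝕜 N X p α (shift 𝕜 N X p β x) = shift 𝕜 N X p (α + β) x :=
  SeqSpace.ext fun i => by simp only [shift_apply, sub_sub]

theorem shift_zero (x : SeqSpace 𝕜 N X p) : shift 𝕜 N X p 0 x = x :=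
  SeqSpace.ext fun i => by rw [shift_apply, sub_zero]

theorem norm_shift_apply_le (α : Idx N) (x : SeqSpace 𝕜 N X p) : ‖shift 𝕜 N X p α x‖ ≤ ‖x‖ :=
  norm_shift_le α x.1

theorem norm_shift_apply (α : Idx N) (x : SeqSpace 𝕜 N X p) : ‖shift 𝕜 N X p α x‖ = ‖x‖ := by
  refine le_antisymm (norm_shift_apply_le α x) ?_
  have h := norm_shift_apply_le (-α) (shift 𝕜 N X p α x)
  rwa [shift_shift, neg_add_cancel, shift_zero] at h

theorem mem_cube_iff {n : ℕ} {i : Idx N} : i ∈ cube N n ↔ ‖i‖ ≤ n := by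
  rw [pi_norm_le_iff_of_nonneg (Nat.cast_nonneg n)]
  refine forall_congr' fun k => ?_
  rw [Int.norm_eq_abs, ← abs_le]
  norm_cast

theorem proj_eq_self {m : ℕ} {x : SeqSpace 𝕜 N X p} (h : ∀ i, x i ≠ 0 → ‖i‖ ≤ m) :
    proj 𝕜 N X p m x = x :=
  SeqSpace.ext fun i => by
    classical
    rw [proj_apply, ite_eq_left_iff]
    intro hi
    by_contra h0
    exact hi (mem_cube_iff.2 (h i (Ne.symm h0)))

/-! ### Scalar multiplication operators -/

variable (𝕜 X p) in
/-- The multiplication by a scalar function that is bounded by `1`. -/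
def scalOp (w : Idx N → ℝ) (hw : ∀ i, |w i| ≤ 1) : Op 𝕜 N X p :=
  mulOp ⟨fun i => (w i : 𝕜) • ContinuousLinearMap.id 𝕜 X, memℓp_infty ⟨1, by
    rintro _ ⟨i, rfl⟩
    dsimp only
    rw [norm_smul, RCLike.norm_ofReal]
    exact mul_le_one₀ (hw i) (norm_nonneg _) ContinuousLinearMap.norm_id_le⟩⟩

theorem scalOp_apply (w : Idx N → ℝ) (hw : ∀ i, |w i| ≤ 1) (x : SeqSpace 𝕜 N X p) (i : Idx N) :
    scalOp 𝕜 X p w hw x i = (w i : 𝕜) • x i := rfl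

theorem norm_scalOp_apply (w : Idx N → ℝ) (hw : ∀ i, |w i| ≤ 1) (x : SeqSpace 𝕜 N X p)
    (i : Idx N) : ‖scalOp 𝕜 X p w hw x i‖ = |w i| * ‖x i‖ := by
  rw [scalOp_apply, norm_smul, RCLike.norm_ofReal]

theorem norm_scalOp_le {w : Idx N → ℝ} (hw : ∀ i, |w i| ≤ 1) {c : ℝ} (hc : 0 ≤ c)
    (h : ∀ i, |w i| ≤ c) (x : SeqSpace 𝕜 N X p) : ‖scalOp 𝕜 X p w hw x‖ ≤ c * ‖x‖ :=
  SeqSpace.norm_le_mul hc fun i => by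
    rw [norm_scalOp_apply]
    exact mul_le_mul_of_nonneg_right (h i) (norm_nonneg _)

theorem norm_scalOp_le_norm (w : Idx N → ℝ) (hw : ∀ i, |w i| ≤ 1) (x : SeqSpace 𝕜 N X p) :
    ‖scalOp 𝕜 X p w hw x‖ ≤ ‖x‖ := by
  simpa using norm_scalOp_le hw zero_le_one hw x

/-! ### Tent functions -/

variable (N) in
/-- The tent of width `n` around the origin. -/
def tent (n : ℕ) (k : Idx N) : ℝ := max 0 (1 - ‖k‖ / n)

theorem tent_nonneg (n : ℕ) (k : Idx N) : 0 ≤ tent N n k := le_max_left _ _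

theorem tent_le_one (n : ℕ) (k : Idx N) : tent N n k ≤ 1 :=
  max_le zero_le_one (sub_le_self _ (by positivity))

theorem abs_tent_le_one (n : ℕ) (k : Idx N) : |tent N n k| ≤ 1 := by
  rw [abs_of_nonneg (tent_nonneg n k)]
  exact tent_le_one n k

theorem tent_zero (n : ℕ) : tent N n 0 = 1 := by simp [tent]

theorem norm_le_of_tent_ne_zero {n : ℕ} (hn : 0 < n) {k : Idx N} (h : tent N n k ≠ 0) :
    ‖k‖ ≤ n := by
  by_contra! hk
  refine h (max_eq_left ?_)
  have : 1 ≤ ‖k‖ / n := (one_le_div (by exact_mod_cast hn)).2 hk.le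
  linarith

/-- The difference of a tent and its translate. -/
def tentDiff (n : ℕ) (α k : Idx N) : ℝ := tent N n (k - α) - tent N n k

theorem abs_tentDiff_le_one (n : ℕ) (α k : Idx N) : |tentDiff n α k| ≤ 1 := by
  rw [tentDiff, abs_le]
  constructor <;>
    linarith [tent_nonneg n k, tent_nonneg n (k - α), tent_le_one n k, tent_le_one n (k - α)]

/-- A tent of width `n` is Lipschitz with constant `1/n`, and truncation at `0` preserves this. -/
theorem abs_tentDiff_le (n : ℕ) (α k : Idx N) : |tentDiff n α k| ≤ ‖α‖ / n := by
  refine (abs_max_sub_max_le_max _ _ _ _).trans (max_le (by simp; positivity) ?_)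
  have : 1 - ‖k - α‖ / n - (1 - ‖k‖ / n) = (‖k‖ - ‖k - α‖) / n := by ring
  rw [this, abs_div, Nat.abs_cast]
  gcongr
  simpa using abs_norm_sub_norm_le k (k - α)

variable (𝕜 X p) in
/-- The multiplication by the tent of width `n` around `j`. -/
def tentOp (n : ℕ) (j : Idx N) : Op 𝕜 N X p :=
  scalOp 𝕜 X p (fun i => tent N n (i - j)) fun _ => abs_tent_le_one n _

variable (𝕜 X p) in
/-- The multiplication by the difference of a tent around `j` and its translate by `α`. -/
def tentDiffOp (n : ℕ) (α j : Idx N) : Op 𝕜 N X p :=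
  scalOp 𝕜 X p (fun i => tentDiff n α (i - j)) fun _ => abs_tentDiff_le_one n α _

theorem tentOp_apply (n : ℕ) (j : Idx N) (x : SeqSpace 𝕜 N X p) (i : Idx N) :
    tentOp 𝕜 X p n j x i = (tent N n (i - j) : 𝕜) • x i := rfl

theorem tentDiffOp_apply (n : ℕ) (α j : Idx N) (x : SeqSpace 𝕜 N X p) (i : Idx N) :
    tentDiffOp 𝕜 X p n α j x i = (tentDiff n α (i - j) : 𝕜) • x i := rfl

theorem norm_tentOp_le (n : ℕ) (j : Idx N) (x : SeqSpace 𝕜 N X p) :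
    ‖tentOp 𝕜 X p n j x‖ ≤ ‖x‖ := norm_scalOp_le_norm _ _ _

theorem norm_apply_le_norm_tentOp (n : ℕ) (j : Idx N) (x : SeqSpace 𝕜 N X p) :
    ‖x j‖ ≤ ‖tentOp 𝕜 X p n j x‖ := by
  have h := SeqSpace.norm_apply_le (tentOp 𝕜 X p n j x) j
  rwa [tentOp_apply, sub_self, tent_zero, RCLike.ofReal_one, one_smul] at h

theorem norm_tentDiffOp_le (n : ℕ) (α j : Idx N) (x : SeqSpace 𝕜 N X p) :
    ‖tentDiffOp 𝕜 X p n α j x‖ ≤ ‖α‖ / n * ‖x‖ :=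
  norm_scalOp_le _ (by positivity) (fun _ => abs_tentDiff_le n α _) x

theorem tentOp_apply_ne_zero {n : ℕ} (hn : 0 < n) {j : Idx N} {x : SeqSpace 𝕜 N X p} {i : Idx N}
    (h : tentOp 𝕜 X p n j x i ≠ 0) : x i ≠ 0 ∧ ‖i - j‖ ≤ n := by
  rw [tentOp_apply, smul_ne_zero_iff] at h
  exact ⟨h.2, norm_le_of_tent_ne_zero hn (by exact_mod_cast h.1)⟩

theorem shift_tentOp (n : ℕ) (h j : Idx N) (x : SeqSpace 𝕜 N X p) :
    shift 𝕜 N X p h (tentOp 𝕜 X p n j x) = tentOp 𝕜 X p n (j + h) (shift 𝕜 N X p h x) :=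
  SeqSpace.ext fun i => by
    rw [shift_apply, tentOp_apply, tentOp_apply, shift_apply, sub_sub, add_comm h j]

/-- The commutator of a band operator with a tent. -/
theorem norm_band_tentOp_sub_le (s : Finset (Idx N))
    (a : Idx N → lp (fun _ : Idx N => X →L[𝕜] X) ∞) (n : ℕ) (j : Idx N) (x : SeqSpace 𝕜 N X p) :
    ‖(∑ α ∈ s, mulOp (a α) * shift 𝕜 N X p α : Op 𝕜 N X p) (tentOp 𝕜 X p n j x) -
        tentOp 𝕜 X p n j ((∑ α ∈ s, mulOp (a α) * shift 𝕜 N X p α : Op 𝕜 N X p) x)‖ ≤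
      ∑ α ∈ s, ‖a α‖ * ‖tentDiffOp 𝕜 X p n α j (shift 𝕜 N X p α x)‖ := by
  -- Operator coefficients commute with scalar multipliers, so only the displacement of the tent by
  -- the shift survives.
  have h1 : ∀ α, (mulOp (a α) * shift 𝕜 N X p α : Op 𝕜 N X p) (tentOp 𝕜 X p n j x) -
      tentOp 𝕜 X p n j ((mulOp (a α) * shift 𝕜 N X p α : Op 𝕜 N X p) x) =
      mulOp (a α) (tentDiffOp 𝕜 X p n α j (shift 𝕜 N X p α x)) := by
    intro α
    refine SeqSpace.ext fun i => ?_
    rw [SeqSpace.sub_apply, mul_apply_eq_comp, mul_apply_eq_comp,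
      mulOp_apply, shift_apply, tentOp_apply, tentOp_apply, mulOp_apply, shift_apply, mulOp_apply,
      tentDiffOp_apply, shift_apply, ← map_smul, ← map_sub, ← sub_smul, tentDiff,
      RCLike.ofReal_sub, sub_right_comm]
  rw [sum_apply, sum_apply, map_sum,
    ← Finset.sum_sub_distrib]
  refine (norm_sum_le _ _).trans (Finset.sum_le_sum fun α _ => ?_)
  rw [h1]
  exact norm_mulOp_le _ _

theorem IsBandDominated.exists_band {A : Op 𝕜 N X p} (hA : IsBandDominated A) {δ : ℝ}
    (hδ : 0 < δ) : ∃ B, IsBand B ∧ ‖A - B‖ < δ := by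
  obtain ⟨B, hB, hlim⟩ := hA
  obtain ⟨n, hn⟩ := (Metric.tendsto_nhds.1 hlim δ hδ).exists
  exact ⟨B n, hB n, by rwa [dist_comm, dist_eq_norm] at hn⟩

/-- Band-dominated operators almost commute with wide tents. -/
theorem IsBandDominated.exists_tentOp_commutator_le {A : Op 𝕜 N X p} (hA : IsBandDominated A)
    {δ : ℝ} (hδ : 0 < δ) : ∃ n : ℕ, 0 < n ∧ ∀ (j : Idx N) (x : SeqSpace 𝕜 N X p),
      ‖A (tentOp 𝕜 X p n j x) - tentOp 𝕜 X p n j (A x)‖ ≤ δ * ‖x‖ := by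
  -- The approximation error enters twice, on either side of the tent; the band part gets the
  -- remaining `δ / 2`.
  obtain ⟨B, ⟨s, a, rfl⟩, hAB⟩ := hA.exists_band (show 0 < δ / 4 by positivity)
  set B := ∑ α ∈ s, mulOp (a α) * shift 𝕜 N X p α with hB
  set S := ∑ α ∈ s, ‖a α‖ * ‖α‖ with hS
  have hS0 : 0 ≤ S := Finset.sum_nonneg fun _ _ => by positivity
  obtain ⟨n, hn⟩ := exists_nat_gt (2 * S / δ)
  have hn0 : (0 : ℝ) < n := lt_of_le_of_lt (by positivity) hn
  refine ⟨n, by exact_mod_cast hn0, fun j x => ?_⟩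
  have h1 : ‖B (tentOp 𝕜 X p n j x) - tentOp 𝕜 X p n j (B x)‖ ≤ S / n * ‖x‖ := by
    refine (norm_band_tentOp_sub_le s a n j x).trans ?_
    rw [hS, Finset.sum_div, Finset.sum_mul]
    refine Finset.sum_le_sum fun α _ => ?_
    have := norm_tentDiffOp_le n α j (shift 𝕜 N X p α x)
    rw [norm_shift_apply] at this
    calc _ ≤ ‖a α‖ * (‖α‖ / n * ‖x‖) := by gcongr
      _ = _ := by ring
  have h2 : S / n ≤ δ / 2 := by
    rw [div_lt_iff₀ hδ] at hn
    rw [div_le_iff₀ hn0]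
    linarith
  have h3 : ‖(A - B) (tentOp 𝕜 X p n j x)‖ ≤ δ / 4 * ‖x‖ :=
    ((A - B).le_of_opNorm_le hAB.le _).trans (by gcongr; exact norm_tentOp_le n j x)
  have h4 : ‖tentOp 𝕜 X p n j ((A - B) x)‖ ≤ δ / 4 * ‖x‖ :=
    (norm_tentOp_le n j _).trans ((A - B).le_of_opNorm_le hAB.le _)
  have h5 : A (tentOp 𝕜 X p n j x) - tentOp 𝕜 X p n j (A x) =
      (B (tentOp 𝕜 X p n j x) - tentOp 𝕜 X p n j (B x)) + (A - B) (tentOp 𝕜 X p n j x) -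
        tentOp 𝕜 X p n j ((A - B) x) := by
    simp only [sub_apply, map_sub]
    abel
  rw [h5]
  refine (norm_sub_le _ _).trans ((add_le_add_left (norm_add_le _ _) _).trans ?_)
  have h6 : S / n * ‖x‖ ≤ δ / 2 * ‖x‖ := by gcongr
  linarith

end Basic

/-! ### Averaging over translates and the `l^q` norms of tents. -/

section Summation

variable {𝕜 : Type*} [RCLike 𝕜] {N : ℕ} {X : Type*} [NormedAddCommGroup X] [NormedSpace 𝕜 X]
  {p : ℝ≥0∞} [hp : Fact (p = 0 ∨ 1 ≤ p)]

theorem SeqSpace.enorm_rpow_eq_tsum (hq : normExp p ≠ ∞) (y : SeqSpace 𝕜 N X p) :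
    ‖y‖ₑ ^ (normExp p).toReal = ∑' i, ‖y i‖ₑ ^ (normExp p).toReal := by
  have h0 : 0 < (normExp p).toReal := ENNReal.toReal_pos (normExp_ne_zero p) hq
  have h := lp.hasSum_norm h0 y.1
  have h1 : ∀ {E : Type _} [SeminormedAddCommGroup E] (z : E),
      ‖z‖ₑ ^ (normExp p).toReal = ENNReal.ofReal (‖z‖ ^ (normExp p).toReal) := by
    intro E _ z
    rw [← ofReal_norm, ENNReal.ofReal_rpow_of_nonneg (norm_nonneg _) h0.le]
  refine (h1 y).trans (Eq.trans ?_ (tsum_congr fun i => (h1 (y i)).symm))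
  rw [← ENNReal.ofReal_tsum_of_nonneg (fun _ => by positivity) h.summable, h.tsum_eq]
  rfl

/-- Averaging over all translates of a multiplier. -/
theorem eLpNorm_scalOp_translates (hq : normExp p ≠ ∞) (w : Idx N → ℝ) (hw : ∀ i, |w i| ≤ 1)
    (y : SeqSpace 𝕜 N X p) :
    eLpNorm (fun j => ‖scalOp 𝕜 X p (fun i => w (i - j)) (fun _ => hw _) y‖) (normExp p)
      Measure.count = eLpNorm w (normExp p) Measure.count * ‖y‖ₑ := by
  have h0 : 0 < (normExp p).toReal := ENNReal.toReal_pos (normExp_ne_zero p) hq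
  rw [eLpNorm_eq_lintegral_rpow_enorm_toReal (normExp_ne_zero p) hq,
    eLpNorm_eq_lintegral_rpow_enorm_toReal (normExp_ne_zero p) hq, lintegral_count,
    lintegral_count]
  have h1 : ∀ j, ‖‖scalOp 𝕜 X p (fun i => w (i - j)) (fun _ => hw _) y‖‖ₑ ^ (normExp p).toReal =
      ∑' i, ‖w (i - j)‖ₑ ^ (normExp p).toReal * ‖y i‖ₑ ^ (normExp p).toReal := by
    intro j
    rw [enorm_norm, SeqSpace.enorm_rpow_eq_tsum hq]
    refine tsum_congr fun i => ?_
    rw [← ENNReal.mul_rpow_of_nonneg _ _ h0.le, scalOp_apply, enorm_smul]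
    congr 2
    rw [← ofReal_norm, ← ofReal_norm, RCLike.norm_ofReal, Real.norm_eq_abs]
  simp_rw [h1]
  -- By Tonelli the sum over centres `j` may be taken first; by translation invariance it does not
  -- depend on `i`.
  rw [ENNReal.tsum_comm]
  have h2 : ∀ i : Idx N, ∑' j, ‖w (i - j)‖ₑ ^ (normExp p).toReal * ‖y i‖ₑ ^ (normExp p).toReal =
      (∑' k, ‖w k‖ₑ ^ (normExp p).toReal) * ‖y i‖ₑ ^ (normExp p).toReal := by
    intro i
    rw [ENNReal.tsum_mul_right]
    congr 1
    exact (Equiv.subLeft i).tsum_eq fun k => ‖w k‖ₑ ^ (normExp p).toReal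
  simp_rw [h2]
  rw [ENNReal.tsum_mul_left, ← SeqSpace.enorm_rpow_eq_tsum hq,
    ENNReal.mul_rpow_of_nonneg _ _ (by positivity), one_div, ENNReal.rpow_rpow_inv h0.ne']

theorem count_cube (r : ℕ) : Measure.count (cube N r) = ((2 * r + 1) ^ N : ℕ) := by
  have h : cube N r = (Finset.Icc (fun _ => -(r : ℤ)) (fun _ => (r : ℤ)) : Finset (Idx N)) := by
    ext i
    simp only [cube, Set.mem_ofPred_eq, Finset.coe_Icc, Set.mem_Icc, Pi.le_def, forall_and]
  rw [h, Measure.count_apply_finset, Pi.card_Icc]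
  simp only [Int.card_Icc, Finset.prod_const, Finset.card_univ, Fintype.card_fin]
  congr 3
  omega

variable {q : ℝ≥0∞}

theorem eLpNorm_tent_le (n : ℕ) (hn : 0 < n) :
    eLpNorm (tent N n) q Measure.count ≤
      eLpNorm ((cube N n).indicator fun _ => (1 : ℝ)) q Measure.count := by
  refine eLpNorm_mono_real fun k => ?_
  by_cases hk : k ∈ cube N n
  · rw [Set.indicator_of_mem hk]
    exact abs_tent_le_one n k
  · rw [Set.indicator_of_notMem hk, norm_le_zero_iff]
    by_contra h
    exact hk (mem_cube_iff.2 (norm_le_of_tent_ne_zero hn h))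

theorem eLpNorm_indicator_cube (hq0 : q ≠ 0) (hq : q ≠ ∞) (r : ℕ) (c : ℝ) :
    eLpNorm ((cube N r).indicator fun _ => c) q Measure.count =
      ‖c‖ₑ * (((2 * r + 1) ^ N : ℕ) : ℝ≥0∞) ^ (1 / q.toReal) := by
  rw [eLpNorm_indicator_const (MeasurableSet.of_discrete) hq0 hq, count_cube]

theorem eLpNorm_tent_ne_top (hq0 : q ≠ 0) (hq : q ≠ ∞) (n : ℕ) (hn : 0 < n) :
    eLpNorm (tent N n) q Measure.count ≠ ∞ := by
  refine ne_top_of_le_ne_top ?_ (eLpNorm_tent_le n hn)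
  rw [eLpNorm_indicator_cube hq0 hq]
  exact ENNReal.mul_ne_top enorm_ne_top
    (ENNReal.rpow_ne_top_of_nonneg (by positivity) (ENNReal.natCast_ne_top _))

/-- The width is even so that the tent is at least `1/2` on a cube of half its width. -/
theorem le_eLpNorm_tent (m : ℕ) (hm : 0 < m) :
    eLpNorm ((cube N m).indicator fun _ => (1 / 2 : ℝ)) q Measure.count ≤
      eLpNorm (tent N (2 * m)) q Measure.count := by
  refine eLpNorm_mono_real fun k => ?_
  by_cases hk : k ∈ cube N m
  · rw [Set.indicator_of_mem hk, Real.norm_of_nonneg (by norm_num)]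
    refine le_max_of_le_right ?_
    have h1 := mem_cube_iff.1 hk
    have h2 : ‖k‖ / ((2 * m : ℕ) : ℝ) ≤ 1 / 2 := by
      have : (0 : ℝ) < m := by exact_mod_cast hm
      push_cast
      rw [div_le_iff₀ (by positivity)]
      linarith
    linarith
  · rw [Set.indicator_of_notMem hk, norm_zero]
    exact tent_nonneg _ _

theorem eLpNorm_tent_ne_zero (hq0 : q ≠ 0) (hq : q ≠ ∞) (m : ℕ) (hm : 0 < m) :
    eLpNorm (tent N (2 * m)) q Measure.count ≠ 0 := by
  refine (lt_of_lt_of_le ?_ (le_eLpNorm_tent m hm)).ne'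
  rw [eLpNorm_indicator_cube hq0 hq]
  refine ENNReal.mul_pos (by simp) (ENNReal.rpow_pos ?_ (ENNReal.natCast_ne_top _)).ne'
  exact_mod_cast Nat.pow_pos (Nat.succ_pos _)

/-- The difference is at most `‖α‖ / (2m)` and vanishes off the cube of radius `4m`, which has at
most `4^N` times as many points as that of radius `m`, where the tent is at least `1/2`. Thus the
ratio of the norms tends to `0` as `m` grows, which is what makes averaging work. -/
theorem eLpNorm_tentDiff_le (hq1 : 1 ≤ q) (hq : q ≠ ∞) (m : ℕ) (hm : 0 < m) (α : Idx N)
    (hα : ‖α‖ ≤ m) :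
    eLpNorm (tentDiff (2 * m) α) q Measure.count ≤
      ENNReal.ofReal (‖α‖ / m * 4 ^ N) * eLpNorm (tent N (2 * m)) q Measure.count := by
  have hq0 : q ≠ 0 := (zero_lt_one.trans_le hq1).ne'
  have hm0 : (0 : ℝ) < m := by exact_mod_cast hm
  have hr1 : 1 ≤ q.toReal := by
    simpa using ENNReal.toReal_mono hq hq1
  have h1 : eLpNorm (tentDiff (2 * m) α) q Measure.count ≤
      eLpNorm ((cube N (4 * m)).indicator fun _ => ‖α‖ / (2 * m : ℕ)) q Measure.count := by
    refine eLpNorm_mono_real fun k => ?_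
    by_cases hk : k ∈ cube N (4 * m)
    · rw [Set.indicator_of_mem hk]
      exact abs_tentDiff_le _ _ _
    · rw [Set.indicator_of_notMem hk, norm_le_zero_iff, tentDiff]
      rw [mem_cube_iff, not_le] at hk
      push_cast at hk
      have h2 : tent N (2 * m) k = 0 := by
        by_contra h
        have := norm_le_of_tent_ne_zero (by omega) h
        push_cast at this
        linarith
      have h3 : tent N (2 * m) (k - α) = 0 := by
        by_contra h
        have := norm_le_of_tent_ne_zero (by omega) h
        have h4 := norm_le_norm_sub_add k α
        push_cast at this
        linarith
      rw [h2, h3, sub_zero]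
  refine h1.trans (le_trans ?_ (mul_le_mul_right (le_eLpNorm_tent m hm) _))
  rw [eLpNorm_indicator_cube hq0 hq, eLpNorm_indicator_cube hq0 hq]
  have h2 : (((2 * (4 * m) + 1) ^ N : ℕ) : ℝ≥0∞) ^ (1 / q.toReal) ≤
      ENNReal.ofReal (4 ^ N) * (((2 * m + 1) ^ N : ℕ) : ℝ≥0∞) ^ (1 / q.toReal) := by
    have h3 : (((2 * (4 * m) + 1) ^ N : ℕ) : ℝ≥0∞) ≤
        ENNReal.ofReal (4 ^ N) * (((2 * m + 1) ^ N : ℕ) : ℝ≥0∞) := by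
      have : (2 * (4 * m) + 1) ^ N ≤ 4 ^ N * (2 * m + 1) ^ N := by
        rw [← mul_pow]
        exact Nat.pow_le_pow_left (by omega) N
      rw [ENNReal.ofReal_pow (by norm_num)]
      have h4 : ENNReal.ofReal 4 = ((4 : ℕ) : ℝ≥0∞) := by simp
      rw [h4]
      exact_mod_cast this
    refine (ENNReal.rpow_le_rpow h3 (by positivity)).trans ?_
    rw [ENNReal.mul_rpow_of_nonneg _ _ (by positivity)]
    refine mul_le_mul_left ?_ _
    have h5 : (1 : ℝ≥0∞) ≤ ENNReal.ofReal (4 ^ N) := by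
      rw [← ENNReal.ofReal_one]
      exact ENNReal.ofReal_le_ofReal (one_le_pow₀ (by norm_num))
    -- Since `1 / q ≤ 1`, the root of `4^N` is at most `4^N`, giving a bound independent of `q`.
    calc _ ≤ ENNReal.ofReal (4 ^ N) ^ (1 : ℝ) :=
          ENNReal.rpow_le_rpow_of_exponent_le h5 (by
            rw [one_div]
            exact inv_le_one_of_one_le₀ hr1)
      _ = _ := ENNReal.rpow_one _
  calc _ ≤ ‖‖α‖ / (2 * m : ℕ)‖ₑ *
        (ENNReal.ofReal (4 ^ N) * (((2 * m + 1) ^ N : ℕ) : ℝ≥0∞) ^ (1 / q.toReal)) := by gcongr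
    _ = _ := by
      rw [← mul_assoc, ← mul_assoc]
      congr 1
      rw [Real.enorm_of_nonneg (by positivity), Real.enorm_of_nonneg (by norm_num),
        ← ENNReal.ofReal_mul (by positivity), ← ENNReal.ofReal_mul (by positivity)]
      congr 1
      push_cast
      field_simp

end Summation

/-! ### Localization of almost-kernel vectors. -/

section Localization

variable {𝕜 : Type*} [RCLike 𝕜] {N : ℕ} {X : Type*} [NormedAddCommGroup X] [NormedSpace 𝕜 X]
  {p : ℝ≥0∞} [hp : Fact (p = 0 ∨ 1 ≤ p)]

/-- The tent equals `1` at its centre, so centring it where `‖x j‖` is nearly `‖x‖` loses almost no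
norm, while the commutator adds only `δ / 2`. -/
theorem IsBandDominated.exists_tentOp_of_top {A : Op 𝕜 N X p} (hA : IsBandDominated A)
    (hq : normExp p = ∞) {δ : ℝ} (hδ : 0 < δ) : ∃ n : ℕ, 0 < n ∧ ∀ (ε : ℝ) (x : SeqSpace 𝕜 N X p),
      0 ≤ ε → x ≠ 0 → ‖A x‖ ≤ ε * ‖x‖ → ∃ j, tentOp 𝕜 X p n j x ≠ 0 ∧
        ‖A (tentOp 𝕜 X p n j x)‖ ≤ (ε + δ) * ‖tentOp 𝕜 X p n j x‖ := by
  obtain ⟨n, hn, h⟩ := hA.exists_tentOp_commutator_le (half_pos hδ)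
  refine ⟨n, hn, fun ε x hε hx hAx => ?_⟩
  have hx0 : 0 < ‖x‖ := norm_pos_iff.2 hx
  have hc : (ε + δ / 2) / (ε + δ) * ‖x‖ < ‖x‖ := by
    refine mul_lt_of_lt_one_left hx0 ((div_lt_one (by positivity)).2 ?_)
    linarith
  obtain ⟨j, hj⟩ := SeqSpace.exists_lt_norm_apply hq x (by positivity) hc
  have hj' := hj.trans_le (norm_apply_le_norm_tentOp (𝕜 := 𝕜) n j x)
  refine ⟨j, norm_pos_iff.1 (lt_of_le_of_lt (by positivity) hj'), ?_⟩
  have h1 : ‖A (tentOp 𝕜 X p n j x)‖ ≤ (ε + δ / 2) * ‖x‖ := by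
    have h2 := norm_le_norm_sub_add (A (tentOp 𝕜 X p n j x)) (tentOp 𝕜 X p n j (A x))
    have h3 := h j x
    have h4 := norm_tentOp_le n j (A x)
    linarith
  rw [div_mul_eq_mul_div, div_lt_iff₀ (by positivity)] at hj'
  linarith

/-- If every centre failed, taking `l^q` norms over all centres would give `ε + 3δ/4 ≤ ‖B x‖ / ‖x‖ +
S / m ≤ ε + δ/2` for a band operator `B` near `A`. A commutator bound relative to `‖x‖` is too weak
here, since one tent may capture only a small part of `x`; the commutators are averaged too. -/
theorem IsBandDominated.exists_tentOp_of_ne_top {A : Op 𝕜 N X p} (hA : IsBandDominated A)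
    (hq : normExp p ≠ ∞) {δ : ℝ} (hδ : 0 < δ) : ∃ n : ℕ, 0 < n ∧ ∀ (ε : ℝ) (x : SeqSpace 𝕜 N X p),
      0 ≤ ε → x ≠ 0 → ‖A x‖ ≤ ε * ‖x‖ → ∃ j, tentOp 𝕜 X p n j x ≠ 0 ∧
        ‖A (tentOp 𝕜 X p n j x)‖ ≤ (ε + δ) * ‖tentOp 𝕜 X p n j x‖ := by
  obtain ⟨B, ⟨s, a, hB⟩, hAB⟩ := hA.exists_band (show 0 < δ / 4 by positivity)
  set S := ∑ α ∈ s, ‖a α‖ * (‖α‖ * 4 ^ N) with hS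
  have hS0 : 0 ≤ S := Finset.sum_nonneg fun _ _ => by positivity
  -- The first summand makes `S / m ≤ δ / 4`; the second makes `m` exceed every shift length.
  obtain ⟨m, hm⟩ := exists_nat_gt (4 * S / δ + ∑ α ∈ s, ‖α‖)
  have hα0 : 0 ≤ ∑ α ∈ s, ‖α‖ := Finset.sum_nonneg fun _ _ => norm_nonneg _
  have hSδ : 0 ≤ 4 * S / δ := by positivity
  have hm0 : (0 : ℝ) < m := by linarith
  have hm0' : 0 < m := by exact_mod_cast hm0
  have hαm : ∀ α ∈ s, ‖α‖ ≤ m := fun α hα => by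
    have := Finset.single_le_sum (f := fun α : Idx N => ‖α‖) (fun _ _ => norm_nonneg _) hα
    linarith
  have hSm : S / m ≤ δ / 4 := by
    have h1 : 4 * S / δ < m := by linarith
    rw [div_lt_iff₀ hδ] at h1
    rw [div_le_iff₀ hm0]
    linarith
  refine ⟨2 * m, by omega, fun ε x hε hx hAx => ?_⟩
  by_contra! hcon
  set F : Idx N → ℝ := fun j => ‖tentOp 𝕜 X p (2 * m) j x‖ with hF
  set G : Idx N → ℝ := fun j => ‖tentOp 𝕜 X p (2 * m) j (B x)‖ with hG
  set H : Idx N → Idx N → ℝ := fun α j =>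
    ‖tentDiffOp 𝕜 X p (2 * m) α j (shift 𝕜 N X p α x)‖ with hH
  have hpt : ∀ j, (ε + 3 * δ / 4) * F j ≤ G j + ∑ α ∈ s, ‖a α‖ * H α j := by
    intro j
    have h1 : (ε + δ) * F j ≤ ‖A (tentOp 𝕜 X p (2 * m) j x)‖ := by
      by_cases h0 : tentOp 𝕜 X p (2 * m) j x = 0
      · simp [hF, h0]
      · exact (hcon j h0).le
    have h2 : ‖(A - B) (tentOp 𝕜 X p (2 * m) j x)‖ ≤ δ / 4 * F j :=
      (A - B).le_of_opNorm_le hAB.le _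
    have h3 := norm_band_tentOp_sub_le s a (2 * m) j x
    rw [← hB] at h3
    have h4 := norm_le_norm_sub_add (B (tentOp 𝕜 X p (2 * m) j x))
      (tentOp 𝕜 X p (2 * m) j (B x))
    have h5 := norm_le_norm_sub_add (A (tentOp 𝕜 X p (2 * m) j x))
      (B (tentOp 𝕜 X p (2 * m) j x))
    rw [← sub_apply] at h5
    simp only [hG, hH]
    linarith
  set q := normExp p with hqdef
  have hq1 : 1 ≤ q := Fact.out
  have hq0 : q ≠ 0 := normExp_ne_zero p
  set μ : Measure (Idx N) := Measure.count
  set W := eLpNorm (tent N (2 * m)) q μ with hW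
  have hWtop : W ≠ ∞ := eLpNorm_tent_ne_top hq0 hq _ (by omega)
  have hW0 : W ≠ 0 := eLpNorm_tent_ne_zero hq0 hq m hm0'
  have hFn : eLpNorm F q μ = W * ‖x‖ₑ :=
    eLpNorm_scalOp_translates hq (tent N (2 * m)) (abs_tent_le_one _) x
  have hGn : eLpNorm G q μ = W * ‖B x‖ₑ :=
    eLpNorm_scalOp_translates hq (tent N (2 * m)) (abs_tent_le_one _) (B x)
  have hHn : ∀ α ∈ s, eLpNorm (H α) q μ ≤ ENNReal.ofReal (‖α‖ / m * 4 ^ N) * W * ‖x‖ₑ := by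
    intro α hα
    have h1 : eLpNorm (H α) q μ =
        eLpNorm (tentDiff (2 * m) α) q μ * ‖shift 𝕜 N X p α x‖ₑ :=
      eLpNorm_scalOp_translates hq (tentDiff (2 * m) α) (abs_tentDiff_le_one _ α) _
    have h2 : ‖shift 𝕜 N X p α x‖ₑ = ‖x‖ₑ := by
      rw [← ofReal_norm, norm_shift_apply, ofReal_norm]
    rw [h1, h2]
    exact mul_le_mul_left (eLpNorm_tentDiff_le hq1 hq m hm0' α (hαm α hα)) _
  have hmeas : ∀ f : Idx N → ℝ, AEStronglyMeasurable f μ := fun f =>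
    (measurable_of_countable f).aestronglyMeasurable
  -- Minkowski's inequality over the centres `j`.
  have hsum : eLpNorm ((ε + 3 * δ / 4) • F) q μ ≤
      eLpNorm G q μ + ∑ α ∈ s, eLpNorm (‖a α‖ • H α) q μ := by
    have h1 : eLpNorm ((ε + 3 * δ / 4) • F) q μ ≤
        eLpNorm (G + ∑ α ∈ s, ‖a α‖ • H α) q μ := by
      refine eLpNorm_mono_real fun j => ?_
      rw [Real.norm_of_nonneg (by simp only [Pi.smul_apply, smul_eq_mul, hF]; positivity)]
      simpa using hpt j
    exact h1.trans ((eLpNorm_add_le (hmeas _) (hmeas _) hq1).trans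
      (add_le_add_right (eLpNorm_sum_le (fun _ _ => hmeas _) hq1) _))
  rw [eLpNorm_const_smul, hFn, hGn] at hsum
  have hsum2 : ‖ε + 3 * δ / 4‖ₑ * (W * ‖x‖ₑ) ≤ W * ‖B x‖ₑ +
      ∑ α ∈ s, ‖a α‖ₑ * (ENNReal.ofReal (‖α‖ / m * 4 ^ N) * W * ‖x‖ₑ) := by
    refine hsum.trans (add_le_add_right (Finset.sum_le_sum fun α hα => ?_) _)
    rw [eLpNorm_const_smul, enorm_norm]
    exact mul_le_mul_right (hHn α hα) _
  clear_value W
  -- The tent norm `W` is finite and nonzero, hence cancels from both sides once they are real.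
  lift W to NNReal using hWtop
  have hW1 : 0 < (W : ℝ) := by
    have : W ≠ 0 := by simpa using hW0
    positivity
  have hreal : (ε + 3 * δ / 4) * (W * ‖x‖) ≤ W * ‖B x‖ +
      ∑ α ∈ s, ‖a α‖ * (‖α‖ / m * 4 ^ N * W * ‖x‖) := by
    have hterm : ∀ α ∈ s,
        ‖a α‖ₑ * (ENNReal.ofReal (‖α‖ / m * 4 ^ N) * (W : ℝ≥0∞) * ‖x‖ₑ) ≠ ∞ := fun α _ =>
      ENNReal.mul_ne_top enorm_ne_top (ENNReal.mul_ne_top (ENNReal.mul_ne_top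
        ENNReal.ofReal_ne_top ENNReal.coe_ne_top) enorm_ne_top)
    have hfirst : (W : ℝ≥0∞) * ‖B x‖ₑ ≠ ∞ := ENNReal.mul_ne_top ENNReal.coe_ne_top enorm_ne_top
    have hsumtop := ENNReal.sum_ne_top.2 hterm
    have := ENNReal.toReal_mono (ENNReal.add_ne_top.2 ⟨hfirst, hsumtop⟩) hsum2
    rw [ENNReal.toReal_add hfirst hsumtop, ENNReal.toReal_sum hterm] at this
    simp only [ENNReal.toReal_mul, toReal_enorm, ENNReal.coe_toReal] at this
    rw [Real.norm_of_nonneg (by positivity)] at this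
    refine this.trans (le_of_eq ?_)
    congr 1
    refine Finset.sum_congr rfl fun α _ => ?_
    rw [ENNReal.toReal_ofReal (by positivity)]
  have hsumS : ∑ α ∈ s, ‖a α‖ * (‖α‖ / m * 4 ^ N * W * ‖x‖) = W * (S / m * ‖x‖) := by
    rw [hS, Finset.sum_div, Finset.sum_mul, Finset.mul_sum]
    refine Finset.sum_congr rfl fun α _ => ?_
    ring
  have hBx : ‖B x‖ ≤ (ε + δ / 4) * ‖x‖ := by
    have h1 : ‖(A - B) x‖ ≤ δ / 4 * ‖x‖ := (A - B).le_of_opNorm_le hAB.le _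
    have h2 := norm_le_norm_sub_add (B x) (A x)
    rw [norm_sub_rev, ← sub_apply] at h2
    linarith
  rw [hsumS, mul_left_comm, ← mul_add] at hreal
  have h6 := le_of_mul_le_mul_left hreal hW1
  have hx0 : 0 < ‖x‖ := norm_pos_iff.2 hx
  have h7 : S / m * ‖x‖ ≤ δ / 4 * ‖x‖ := by gcongr
  have h8 : 0 < δ * ‖x‖ := by positivity
  linarith

/-- Almost minimizers of `‖A x‖ / ‖x‖` can be cut down to supports of a uniform size. -/
theorem IsBandDominated.exists_localization {A : Op 𝕜 N X p} (hA : IsBandDominated A) {δ : ℝ}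
    (hδ : 0 < δ) : ∃ D : ℕ, ∀ (ε : ℝ) (x : SeqSpace 𝕜 N X p), 0 ≤ ε → x ≠ 0 → ‖A x‖ ≤ ε * ‖x‖ →
      ∃ y : SeqSpace 𝕜 N X p, y ≠ 0 ∧ ‖A y‖ ≤ (ε + δ) * ‖y‖ ∧ (∀ i, y i ≠ 0 → x i ≠ 0) ∧
        ∀ i j, y i ≠ 0 → y j ≠ 0 → ‖i - j‖ ≤ D := by
  have h : ∃ n : ℕ, 0 < n ∧ ∀ (ε : ℝ) (x : SeqSpace 𝕜 N X p),
      0 ≤ ε → x ≠ 0 → ‖A x‖ ≤ ε * ‖x‖ → ∃ j, tentOp 𝕜 X p n j x ≠ 0 ∧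
        ‖A (tentOp 𝕜 X p n j x)‖ ≤ (ε + δ) * ‖tentOp 𝕜 X p n j x‖ := by
    by_cases hq : normExp p = ∞
    · exact hA.exists_tentOp_of_top hq hδ
    · exact hA.exists_tentOp_of_ne_top hq hδ
  obtain ⟨n, hn, h⟩ := h
  refine ⟨2 * n, fun ε x hε hx hAx => ?_⟩
  obtain ⟨c, hc, hAc⟩ := h ε x hε hx hAx
  refine ⟨_, hc, hAc, fun i hi => (tentOp_apply_ne_zero hn hi).1, fun i j hi hj => ?_⟩
  have h1 := (tentOp_apply_ne_zero hn hi).2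
  have h2 := (tentOp_apply_ne_zero hn hj).2
  have h3 := norm_sub_le_norm_sub_add_norm_sub i c j
  rw [norm_sub_rev c j] at h3
  push_cast
  linarith

/-- Nested localization around a single point. -/
theorem exists_common_center {A : Op 𝕜 N X p} {D : ℕ → ℕ}
    (hD : ∀ (k : ℕ) (ε : ℝ) (x : SeqSpace 𝕜 N X p), 0 ≤ ε → x ≠ 0 → ‖A x‖ ≤ ε * ‖x‖ →
      ∃ y : SeqSpace 𝕜 N X p, y ≠ 0 ∧ ‖A y‖ ≤ (ε + (1 / 2) ^ k) * ‖y‖ ∧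
        (∀ i, y i ≠ 0 → x i ≠ 0) ∧ ∀ i j, y i ≠ 0 → y j ≠ 0 → ‖i - j‖ ≤ D k) (n : ℕ) :
    ∀ (ε : ℝ) (x : SeqSpace 𝕜 N X p), 0 ≤ ε → x ≠ 0 → ‖A x‖ ≤ ε * ‖x‖ →
      ∃ c, x c ≠ 0 ∧ ∀ k < n, ∃ y : SeqSpace 𝕜 N X p, y ≠ 0 ∧
        ‖A y‖ ≤ (ε + 2 * (1 / 2) ^ k - 2 * (1 / 2) ^ n) * ‖y‖ ∧
          ∀ i, y i ≠ 0 → ‖i - c‖ ≤ D k := by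
  induction n with
  | zero =>
    intro ε x _ hx _
    obtain ⟨c, hc⟩ := SeqSpace.exists_ne_zero hx
    exact ⟨c, hc, fun k hk => absurd hk (Nat.not_lt_zero k)⟩
  | succ n ih =>
    intro ε x hε hx hAx
    -- The coarsest cut comes first, so later supports lie inside it; the losses from step `k` on
    -- sum to `2·2^{-k} - 2·2^{-n}`.
    obtain ⟨y, hy, hAy, hyx, hyD⟩ := hD n ε x hε hx hAx
    obtain ⟨c, hc, h⟩ := ih _ y (by positivity) hy hAy
    refine ⟨c, hyx c hc, fun k hk => ?_⟩
    rcases Nat.lt_succ_iff_lt_or_eq.1 hk with hk | rfl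
    · obtain ⟨z, hz, hAz, hzD⟩ := h k hk
      refine ⟨z, hz, hAz.trans (le_of_eq ?_), hzD⟩
      rw [pow_succ]
      ring
    · refine ⟨y, hy, hAy.trans (le_of_eq ?_), fun i hi => hyD i c hi hc⟩
      rw [pow_succ]
      ring

end Localization

/-! ### Transfer between an operator and its limit operators. -/

section LimitOperators

variable {𝕜 : Type*} [RCLike 𝕜] {N : ℕ} {X : Type*} [NormedAddCommGroup X] [NormedSpace 𝕜 X]
  {p : ℝ≥0∞} [hp : Fact (p = 0 ∨ 1 ≤ p)]

theorem PStrongTendsto.tendsto_mul_proj {T : ℕ → Op 𝕜 N X p} {B : Op 𝕜 N X p}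
    (h : PStrongTendsto T B) (m : ℕ) :
    Tendsto (fun n => ‖(T n - B) * proj 𝕜 N X p m‖) atTop (𝓝 0) :=
  squeeze_zero (fun _ => norm_nonneg _) (fun _ => le_add_of_nonneg_left (norm_nonneg _)) (h.2.2 m)

theorem PStrongTendsto.tendsto_proj_mul {T : ℕ → Op 𝕜 N X p} {B : Op 𝕜 N X p}
    (h : PStrongTendsto T B) (m : ℕ) :
    Tendsto (fun n => ‖proj 𝕜 N X p m * (T n - B)‖) atTop (𝓝 0) :=
  squeeze_zero (fun _ => norm_nonneg _) (fun _ => le_add_of_nonneg_right (norm_nonneg _)) (h.2.2 m)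

theorem norm_apply_le_of_support {T : Op 𝕜 N X p} {m : ℕ} {y : SeqSpace 𝕜 N X p}
    (hy : ∀ i, y i ≠ 0 → ‖i‖ ≤ m) : ‖T y‖ ≤ ‖T * proj 𝕜 N X p m‖ * ‖y‖ := by
  have h := (T * proj 𝕜 N X p m).le_opNorm y
  rwa [mul_apply_eq_comp, proj_eq_self hy] at h

theorem PStrongTendsto.tendsto_apply {T : ℕ → Op 𝕜 N X p} {B : Op 𝕜 N X p}
    (h : PStrongTendsto T B) {m : ℕ} {y : SeqSpace 𝕜 N X p} (hy : ∀ i, y i ≠ 0 → ‖i‖ ≤ m) :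
    Tendsto (fun n => T n y) atTop (𝓝 (B y)) := by
  rw [tendsto_iff_norm_sub_tendsto_zero]
  have h1 := (h.tendsto_mul_proj m).mul_const ‖y‖
  rw [zero_mul] at h1
  exact squeeze_zero (fun _ => norm_nonneg _)
    (fun n => norm_apply_le_of_support (T := T n - B) hy) h1

theorem PStrongTendsto.tendsto_proj_apply {T : ℕ → Op 𝕜 N X p} {B : Op 𝕜 N X p}
    (h : PStrongTendsto T B) (m : ℕ) (x : SeqSpace 𝕜 N X p) :
    Tendsto (fun n => proj 𝕜 N X p m (T n x)) atTop (𝓝 (proj 𝕜 N X p m (B x))) := by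
  rw [tendsto_iff_norm_sub_tendsto_zero]
  have h1 := (h.tendsto_proj_mul m).mul_const ‖x‖
  rw [zero_mul] at h1
  refine squeeze_zero (fun _ => norm_nonneg _) (fun n => ?_) h1
  rw [← map_sub]
  exact (proj 𝕜 N X p m * (T n - B)).le_opNorm x

theorem tentOp_support {n : ℕ} (hn : 0 < n) {j : Idx N} {m : ℕ} (hm : ‖j‖ + n ≤ m)
    {x : SeqSpace 𝕜 N X p} {i : Idx N} (h : tentOp 𝕜 X p n j x i ≠ 0) : ‖i‖ ≤ m := by
  have h1 := (tentOp_apply_ne_zero hn h).2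
  have h2 := norm_le_norm_sub_add i j
  linarith

theorem tentOp_proj {n : ℕ} (hn : 0 < n) {j : Idx N} {m : ℕ} (hm : ‖j‖ + n ≤ m)
    (x : SeqSpace 𝕜 N X p) : tentOp 𝕜 X p n j (proj 𝕜 N X p m x) = tentOp 𝕜 X p n j x :=
  SeqSpace.ext fun i => by
    classical
    rw [tentOp_apply, tentOp_apply, proj_apply]
    by_cases hi : i ∈ cube N m
    · rw [if_pos hi]
    · have h0 : tent N n (i - j) = 0 := by
        by_contra h
        have h1 := norm_le_of_tent_ne_zero hn h
        have h2 := norm_le_norm_sub_add i j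
        exact hi (mem_cube_iff.2 (by linarith))
      rw [h0, RCLike.ofReal_zero, zero_smul, zero_smul]

/-- Limit operators inherit the commutator estimates with tents. -/
theorem IsLimitOperator.tentOp_commutator_le {A B : Op 𝕜 N X p} {h : ℕ → Idx N}
    (hB : IsLimitOperator A h B) {n : ℕ} (hn : 0 < n) {δ : ℝ}
    (hA : ∀ (j : Idx N) (x : SeqSpace 𝕜 N X p),
      ‖A (tentOp 𝕜 X p n j x) - tentOp 𝕜 X p n j (A x)‖ ≤ δ * ‖x‖)
    (j : Idx N) (x : SeqSpace 𝕜 N X p) :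
    ‖B (tentOp 𝕜 X p n j x) - tentOp 𝕜 X p n j (B x)‖ ≤ δ * ‖x‖ := by
  -- The tent lives in the cube of radius `m`, so it absorbs `P_m`, and both halves of `𝒫`-strong
  -- convergence apply.
  obtain ⟨m, hm⟩ := exists_nat_ge (‖j‖ + n)
  have h1 := hB.tendsto_apply (y := tentOp 𝕜 X p n j x) fun i hi => tentOp_support hn hm hi
  have h2 := ((tentOp 𝕜 X p n j).continuous.tendsto _).comp (hB.tendsto_proj_apply m x)
  refine le_of_tendsto (h1.sub (by simpa only [tentOp_proj hn hm] using h2)).norm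
    (Eventually.of_forall fun k => ?_)
  have h3 := hA (j + h k) (shift 𝕜 N X p (h k) x)
  rw [norm_shift_apply, ← shift_tentOp] at h3
  refine le_trans (le_of_eq ?_) h3
  -- Conjugation by the shift turns the tent at `j + h k` into the tent at `j`; hence the need for a
  -- bound uniform in the centre.
  rw [← norm_shift_apply (-h k)
    (A (shift 𝕜 N X p (h k) (tentOp 𝕜 X p n j x)) -
      tentOp 𝕜 X p n (j + h k) (A (shift 𝕜 N X p (h k) x))), map_sub,
    shift_tentOp n (-h k),
    add_neg_cancel_right]
  simp only [Function.comp_apply, mul_apply_eq_comp, tentOp_proj hn hm]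

theorem exists_finite_support_of_ne_top (hq : normExp p ≠ ∞) {B : Op 𝕜 N X p} {ε : ℝ}
    {x : SeqSpace 𝕜 N X p} (hx : ‖B x‖ < ε * ‖x‖) :
    ∃ y : SeqSpace 𝕜 N X p, {i | y i ≠ 0}.Finite ∧ ‖B y‖ < ε * ‖y‖ := by
  classical
  have hp0 : p ≠ 0 := by
    rintro rfl
    exact hq (if_pos rfl)
  have hmem : ∀ z : Amb N X p, z ∈ seqSpace 𝕜 N X p := fun z => by
    rw [seqSpace_of_ne_zero _ _ _ _ hp0]
    trivial
  have hs := lp.hasSum_single hq x.1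
  have hs' : Tendsto (fun s : Finset (Idx N) =>
      (⟨∑ i ∈ s, lp.single (normExp p) i (x i), hmem _⟩ : SeqSpace 𝕜 N X p)) atTop (𝓝 x) :=
    tendsto_subtype_rng.2 hs
  have ho : IsOpen {y : SeqSpace 𝕜 N X p | ‖B y‖ < ε * ‖y‖} :=
    isOpen_lt B.continuous.norm (continuous_const.mul continuous_norm)
  obtain ⟨s, hs⟩ := (hs'.eventually (ho.mem_nhds hx)).exists
  refine ⟨_, s.finite_toSet.subset fun i hi => ?_, hs⟩
  by_contra his
  refine hi ?_
  change (∑ k ∈ s, lp.single (normExp p) k (x k) : Amb N X p) i = 0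
  rw [lp.coeFn_sum, Finset.sum_apply]
  refine Finset.sum_eq_zero fun k hk => ?_
  rw [lp.coeFn_single, Pi.single_eq_of_ne]
  rintro rfl
  exact his hk

/-- For finite exponents this is density of finite supports. That density fails in `l^∞`, so for the
sup norm a tent truncates `x`, using the commutator bound inherited from `A`. -/
theorem IsLimitOperator.exists_finite_support {A B : Op 𝕜 N X p} (hA : IsBandDominated A)
    {h : ℕ → Idx N} (hB : IsLimitOperator A h B) {ε : ℝ} (hε : 0 < ε) {x : SeqSpace 𝕜 N X p}
    (hx : ‖B x‖ < ε * ‖x‖) :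
    ∃ (y : SeqSpace 𝕜 N X p) (m : ℕ), (∀ i, y i ≠ 0 → ‖i‖ ≤ m) ∧ ‖B y‖ < ε * ‖y‖ := by
  by_cases hq : normExp p = ∞
  · have hx0 : 0 < ‖x‖ := pos_of_mul_pos_right ((norm_nonneg _).trans_lt hx) hε.le
    obtain ⟨c, hc, hc'⟩ := exists_between hx
    obtain ⟨n, hn, hcomm⟩ := hA.exists_tentOp_commutator_le
      (show 0 < (c - ‖B x‖) / ‖x‖ from div_pos (sub_pos.2 hc) hx0)
    have hc0 : 0 ≤ c := (norm_nonneg _).trans hc.le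
    obtain ⟨j, hj⟩ := SeqSpace.exists_lt_norm_apply hq x (c := c / ε) (by positivity)
      ((div_lt_iff₀' hε).2 hc')
    obtain ⟨m, hm⟩ := exists_nat_ge (‖j‖ + n)
    refine ⟨tentOp 𝕜 X p n j x, m, fun i hi => tentOp_support hn hm hi, ?_⟩
    have h1 := hB.tentOp_commutator_le hn hcomm j x
    rw [div_mul_cancel₀ _ hx0.ne'] at h1
    have h2 := norm_le_norm_sub_add (B (tentOp 𝕜 X p n j x)) (tentOp 𝕜 X p n j (B x))
    have h3 := norm_tentOp_le n j (B x)
    have h4 := hj.trans_le (norm_apply_le_norm_tentOp (𝕜 := 𝕜) n j x)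
    rw [div_lt_iff₀' hε] at h4
    linarith
  · obtain ⟨y, hy, hBy⟩ := exists_finite_support_of_ne_top hq hx
    obtain ⟨r, hr⟩ := (hy.image fun i => ‖i‖).bddAbove
    obtain ⟨m, hm⟩ := exists_nat_ge r
    exact ⟨y, m, fun i hi => (hr ⟨i, hi, rfl⟩).trans hm, hBy⟩

/-- A small value of a limit operator is almost attained by `A` arbitrarily far away. -/
theorem IsLimitOperator.exists_far_support {A B : Op 𝕜 N X p} (hA : IsBandDominated A)
    {h : ℕ → Idx N} (hh : TendsToInfinity h) (hB : IsLimitOperator A h B) {ε : ℝ} (hε : 0 < ε)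
    {x : SeqSpace 𝕜 N X p} (hx : ‖B x‖ < ε * ‖x‖) (R : ℝ) :
    ∃ z : SeqSpace 𝕜 N X p, z ≠ 0 ∧ ‖A z‖ ≤ ε * ‖z‖ ∧ ∀ i, z i ≠ 0 → R ≤ ‖i‖ := by
  obtain ⟨y, m, hy, hBy⟩ := hB.exists_finite_support hA hε hx
  have h1 := (hB.tendsto_apply hy).norm.eventually (gt_mem_nhds hBy)
  obtain ⟨n, hn1, hn2⟩ := (h1.and (hh.eventually_ge_atTop (R + m))).exists
  rw [mul_apply_eq_comp, mul_apply_eq_comp, norm_shift_apply] at hn1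
  refine ⟨shift 𝕜 N X p (h n) y, ?_, ?_, fun i hi => ?_⟩
  · rw [← norm_pos_iff, norm_shift_apply]
    exact pos_of_mul_pos_right ((norm_nonneg _).trans_lt hBy) hε.le
  · rw [norm_shift_apply]
    exact hn1.le
  · rw [shift_apply] at hi
    have h2 := hy _ hi
    have h3 := norm_le_norm_add_norm_sub i (h n)
    linarith

/-- If the limit operators of a rich band-dominated operator are invertible, then they are
uniformly bounded below. -/
theorem IsRich.exists_uniform_lower_bound {A : Op 𝕜 N X p} (hrich : IsRich A)
    (hA : IsBandDominated A) (hinv : ∀ B ∈ opSpectrum A, IsUnit B) :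
    ∃ κ : ℝ, 0 < κ ∧ ∀ B ∈ opSpectrum A, ∀ x, κ * ‖x‖ ≤ ‖B x‖ := by
  by_contra! hcon
  choose D hD using fun k : ℕ => hA.exists_localization (δ := (1 / 2) ^ k) (by positivity)
  have hc : ∀ n : ℕ, ∃ c : Idx N, (n : ℝ) ≤ ‖c‖ ∧ ∀ k < n, ∃ y : SeqSpace 𝕜 N X p, y ≠ 0 ∧
      ‖A y‖ ≤ (1 / ((n : ℝ) + 1) + 2 * (1 / 2) ^ k) * ‖y‖ ∧ ∀ i, y i ≠ 0 → ‖i - c‖ ≤ D k := by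
    intro n
    obtain ⟨B, ⟨h, hh, hB⟩, x, hx⟩ := hcon (1 / ((n : ℝ) + 1)) (by positivity)
    obtain ⟨z, hz, hAz, hzn⟩ := hB.exists_far_support hA hh (by positivity) hx n
    obtain ⟨c, hc, hloc⟩ := exists_common_center hD n _ z (by positivity) hz hAz
    refine ⟨c, hzn c hc, fun k hk => ?_⟩
    obtain ⟨y, hy, hAy, hyc⟩ := hloc k hk
    refine ⟨y, hy, hAy.trans ?_, hyc⟩
    have : (0 : ℝ) < 2 * (1 / 2) ^ n := by positivity
    gcongr
    linarith
  choose c hcn hc using hc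
  have hcinf : TendsToInfinity c := tendsto_atTop_mono hcn tendsto_natCast_atTop_atTop
  obtain ⟨φ, hφ, C, hC⟩ := hrich.2 c hcinf
  obtain ⟨u, hu⟩ := hinv C ⟨c ∘ φ, hcinf.comp hφ.tendsto_atTop, hC⟩
  -- Adding `1` gives positivity without any nontriviality of the space.
  set K := ‖(↑u⁻¹ : Op 𝕜 N X p)‖ + 1 with hK
  have hK0 : 0 < K := by positivity
  have hbelow : ∀ y, ‖y‖ ≤ K * ‖C y‖ := by
    intro y
    have h1 : (↑u⁻¹ : Op 𝕜 N X p) (C y) = y := by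
      rw [← hu, ← mul_apply_eq_comp, Units.inv_mul, one_apply_eq_self]
    calc ‖y‖ = ‖(↑u⁻¹ : Op 𝕜 N X p) (C y)‖ := by rw [h1]
      _ ≤ K * ‖C y‖ := (ContinuousLinearMap.le_opNorm _ _).trans (by gcongr; linarith)
  -- Fixing `k` before `n` fixes the cube of radius `D k`. The terms `2·2^{-k}`, `1/(φ n + 1)` and
  -- the convergence error are each below `1/(4K)`, so their sum stays below the lower bound `1/K`
  -- of `C`.
  obtain ⟨k, hk⟩ := exists_pow_lt_of_lt_one (show 0 < 1 / (8 * K) by positivity)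
    (show (1 / 2 : ℝ) < 1 by norm_num)
  have hη : 0 < 1 / (4 * K) := by positivity
  have e1 := (hC.tendsto_mul_proj (D k)).eventually (gt_mem_nhds hη)
  have e2 := (tendsto_one_div_add_atTop_nhds_zero_nat.comp hφ.tendsto_atTop).eventually
    (gt_mem_nhds hη)
  obtain ⟨n, ⟨hn1, hn2⟩, hn3⟩ := ((e1.and e2).and
    (hφ.tendsto_atTop.eventually_gt_atTop k)).exists
  obtain ⟨y, hy, hAy, hyc⟩ := hc (φ n) k hn3
  set g := c (φ n) with hg
  set y' := shift 𝕜 N X p (-g) y with hy'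
  have hyy' : shift 𝕜 N X p g y' = y := by rw [hy', shift_shift, add_neg_cancel, shift_zero]
  have hnorm : ‖y'‖ = ‖y‖ := norm_shift_apply _ _
  have hsupp : ∀ i, y' i ≠ 0 → ‖i‖ ≤ D k := by
    intro i hi
    rw [hy', shift_apply, sub_neg_eq_add] at hi
    simpa using hyc _ hi
  have h1 := norm_apply_le_of_support
    (T := shift 𝕜 N X p (-g) * A * shift 𝕜 N X p g - C) hsupp
  have h2 : ‖(shift 𝕜 N X p (-g) * A * shift 𝕜 N X p g - C) y'‖ ≤ 1 / (4 * K) * ‖y‖ := by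
    rw [hnorm] at h1
    exact h1.trans (mul_le_mul_of_nonneg_right hn1.le (norm_nonneg _))
  rw [sub_apply, mul_apply_eq_comp, mul_apply_eq_comp, hyy', norm_sub_rev] at h2
  have h3 := norm_le_norm_sub_add (C y') (shift 𝕜 N X p (-g) (A y))
  rw [norm_shift_apply] at h3
  have h4 := hbelow y'
  rw [hnorm] at h4
  have hy0 : 0 < ‖y‖ := norm_pos_iff.2 hy
  have h5 : 1 / ((φ n : ℝ) + 1) + 2 * (1 / 2) ^ k < 1 / (2 * K) := by
    have h6 : 1 / (8 * K) = 1 / K / 8 := by field_simp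
    have h7 : 1 / (4 * K) = 1 / K / 4 := by field_simp
    have h8 : 1 / (2 * K) = 1 / K / 2 := by field_simp
    have hn2' : 1 / ((φ n : ℝ) + 1) < 1 / (4 * K) := hn2
    rw [h7] at hn2'
    rw [h6] at hk
    rw [h8]
    linarith
  have h9 : ‖C y'‖ < 1 / K * ‖y‖ := by
    have h10 := mul_lt_mul_of_pos_right h5 hy0
    have h11 : 1 / K * ‖y‖ = 1 / (4 * K) * ‖y‖ + 1 / (2 * K) * ‖y‖ + 1 / (4 * K) * ‖y‖ := by
      field_simp
      norm_num
    have h12 : 0 < 1 / (4 * K) * ‖y‖ := by positivity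
    linarith
  have h13 := mul_lt_mul_of_pos_left h9 hK0
  rw [← mul_assoc, mul_one_div_cancel hK0.ne', one_mul] at h13
  linarith

end LimitOperators

end LimitOp

end

theorem corollary10 {𝕜 : Type*} [RCLike 𝕜] (N : ℕ) (X : Type*) [NormedAddCommGroup X]
    [NormedSpace 𝕜 X] [CompleteSpace X] (p : ℝ≥0∞) [Fact (p = 0 ∨ 1 ≤ p)]
    (A : LimitOp.Op 𝕜 N X p) (hrich : LimitOp.IsRich A) (hband : LimitOp.IsBandDominated A)
    (hinv : ∀ B ∈ LimitOp.opSpectrum A, IsUnit B) :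
    (∃ C : ℝ, ∀ B ∈ LimitOp.opSpectrum A, ‖Ring.inverse B‖ ≤ C) ∧
      0 < ⨅ B ∈ LimitOp.opSpectrum A, LimitOp.lowerNorm B := by
  obtain ⟨κ, hκ, h⟩ := hrich.exists_uniform_lower_bound hband hinv
  refine ⟨⟨1 / κ, fun B hB => ?_⟩, ?_⟩
  · refine ContinuousLinearMap.opNorm_le_bound _ (by positivity) fun x => ?_
    -- Every `B` here is a unit, so the default value `0` of `Ring.inverse` never occurs.
    have h1 := h B hB (Ring.inverse B x)
    rw [← mul_apply_eq_comp, Ring.mul_inverse_cancel B (hinv B hB), one_apply_eq_self] at h1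
    rw [one_div_mul_eq_div, le_div_iff₀ hκ]
    linarith
  · refine lt_of_lt_of_le (ENNReal.ofReal_pos.2 hκ) (le_iInf₂ fun B hB => ?_)
    refine le_iInf₂ fun y hy => ENNReal.ofReal_le_ofReal ?_
    simpa [hy] using h B hB y
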